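/- Let $G=(V,E)$ be a finite simple graph that is a partial $2$-tree (a subgraph of a $2$-tree, where a $2$-tree is a graph of treewidth $2$ such that adding any edge between two non-adjacent vertices increases the treewidth), and let $w:E\to\mathbb{R}_{\ge 0}$ be an edge-weight function. The weight of a path, and of a cycle, is the sum of the weights of its edges. Call an edge $\{u,v\}\in E$ *long* if the one-edge path $\{u,v\}$ is not a path of minimum weight between $u$ and $v$ in $G$, and let $L\subseteq E$ be the set of long edges. View cycles as edge sets. A *cycle basis* of a graph is a set of cycles of minimum cardinality among the sets $\mathcal{C}$ of cycles such that every cycle of the graph is the symmetric difference of the members of a subset of $\mathcal{C}$; a *minimum cycle basis* is a cycle basis $\mathcal{C}$ of minimum total weight $\sum_{C\in\mathcal{C}}w(C)$. Let $\mathcal{B}$ be any minimum cycle basis of $G\setminus L=(V,E\setminus L)$ and, for every long edge $e=\{u,v\}\in L$, let $P_e$ be the edge set of an arbitrary minimum-weight path between $u$ and $v$ in $G$. Then $$\mathcal{B}\cup\bigl\{\{e\}\cup P_e \;\big|\; e\in L\bigr\}$$ is a minimum cycle basis of $G$. -/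

import Mathlib

/-- A tree decomposition of `G`: a finite tree on the indices `0, …, r - 1`, with a bag of vertices
attached to every index. -/
structure TreeDecomposition {V : Type*} (G : SimpleGraph V) (r : ℕ) where
  tree : SimpleGraph (Fin r)
  isTree : tree.IsTree
  bag : Fin r → Finset V
  cover : ∀ v : V, ∃ i, v ∈ bag i
  edge_cover : ∀ u v : V, G.Adj u v → ∃ i, u ∈ bag i ∧ v ∈ bag i
  subtree : ∀ v : V, (tree.induce {i | v ∈ bag i}).Connected

/-- The width of a tree decomposition: the largest size of a bag, minus one. -/
def TreeDecomposition.width {V : Type*} {G : SimpleGraph V} {r : ℕ}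
    (D : TreeDecomposition G r) : ℕ :=
  (Finset.univ.sup fun i => (D.bag i).card) - 1

/-- The treewidth of a (finite) graph: the least width of a tree decomposition. -/
noncomputable def treewidth {V : Type*} (G : SimpleGraph V) : ℕ :=
  sInf {k | ∃ (r : ℕ) (D : TreeDecomposition G r), D.width = k}

/-- A `k`-tree: a graph of treewidth `k` such that adding any edge between two non-adjacent
vertices increases the treewidth. -/
def IsKTree {V : Type*} (k : ℕ) (G : SimpleGraph V) : Prop :=
  treewidth G = k ∧
    ∀ u v : V, u ≠ v → ¬ G.Adj u v → k < treewidth (G ⊔ SimpleGraph.edge u v)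

/-- A partial `k`-tree: a graph isomorphic to a (not necessarily induced or spanning) subgraph of
a finite `k`-tree. -/
def IsPartialKTree {V : Type*} (k : ℕ) (G : SimpleGraph V) : Prop :=
  ∃ (n : ℕ) (H : SimpleGraph (Fin n)), IsKTree k H ∧ G.IsContained H

/-- The weight of a walk: the sum of the weights of its edges. -/
def walkWeight {V : Type*} {G : SimpleGraph V} (w : Sym2 V → ℝ) {u v : V} (p : G.Walk u v) : ℝ :=
  (p.edges.map w).sum

/-- `p` is a shortest path of `G` between its endpoints. -/
def IsShortestPath {V : Type*} {G : SimpleGraph V} (w : Sym2 V → ℝ) {u v : V}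
    (p : G.Walk u v) : Prop :=
  p.IsPath ∧ ∀ q : G.Walk u v, q.IsPath → walkWeight w p ≤ walkWeight w q

open scoped Classical in
/-- The long edges of `G`: the edges `{u, v}` which are not, as one-edge paths, shortest paths
between `u` and `v`. -/
noncomputable def longEdges {V : Type*} [Fintype V] [DecidableEq V] (G : SimpleGraph V)
    (w : Sym2 V → ℝ) : Finset (Sym2 V) :=
  Finset.univ.filter fun e =>
    ∃ (u v : V) (h : G.Adj u v), e = s(u, v) ∧ ¬ IsShortestPath w h.toWalk

/-- `P` is the edge set of a shortest path of `G` between the two endpoints of `e`. -/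
def IsShortestPathFor {V : Type*} [DecidableEq V] (G : SimpleGraph V) (w : Sym2 V → ℝ)
    (e : Sym2 V) (P : Finset (Sym2 V)) : Prop :=
  ∃ (u v : V) (p : G.Walk u v), e = s(u, v) ∧ IsShortestPath w p ∧ p.edges.toFinset = P

/-- `C` is the edge set of a cycle of `G`. -/
def IsCycleOf {V : Type*} [DecidableEq V] (G : SimpleGraph V) (C : Finset (Sym2 V)) : Prop :=
  ∃ (u : V) (p : G.Walk u u), p.IsCycle ∧ p.edges.toFinset = C

/-- The sum (exclusive or) of a family of edge sets: the edges lying in an odd number of them. -/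
def xorSum {V : Type*} [Fintype V] [DecidableEq V] (F : Finset (Finset (Sym2 V))) :
    Finset (Sym2 V) :=
  Finset.univ.filter fun e => Odd (F.filter fun C => e ∈ C).card

/-- `B` is a set of cycles of `G` that spans the cycle space of `G`. -/
def SpansCycleSpace {V : Type*} [Fintype V] [DecidableEq V] (G : SimpleGraph V)
    (B : Finset (Finset (Sym2 V))) : Prop :=
  (∀ C ∈ B, IsCycleOf G C) ∧ ∀ C, IsCycleOf G C → ∃ F ⊆ B, xorSum F = C

/-- A cycle basis: a set of cycles spanning the cycle space, of minimum cardinality. -/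
def IsCycleBasis {V : Type*} [Fintype V] [DecidableEq V] (G : SimpleGraph V)
    (B : Finset (Finset (Sym2 V))) : Prop :=
  SpansCycleSpace G B ∧ ∀ B', SpansCycleSpace G B' → B.card ≤ B'.card

/-- A minimum cycle basis: a cycle basis of minimum total weight. -/
def IsMinCycleBasis {V : Type*} [Fintype V] [DecidableEq V] (G : SimpleGraph V)
    (w : Sym2 V → ℝ) (B : Finset (Finset (Sym2 V))) : Prop :=
  IsCycleBasis G B ∧
    ∀ B', IsCycleBasis G B' → ∑ C ∈ B, ∑ e ∈ C, w e ≤ ∑ C ∈ B', ∑ e ∈ C, w e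

/-! Over the field with two elements, a cycle basis is minimum exactly when every cycle `D` is a sum
of members no heavier than `D`. One direction is an exchange argument
(`IsMinCycleBasis.mem_span_filter`), the other a matching argument
(`isMinCycleBasis_of_mem_span_filter`).

The criterion is checked for all even edge sets `S`, since these are closed under symmetric
difference (`IsEvenSet.mem_span_of_longEdges`). If `S` contains a long edge `e`, let `C = {e} ∪
P_e`. As `S \ {e}` joins the ends of `e`, it weighs at least `w(P_e)`, so `w(C) ≤ w(S)`. As `w(P_e)
< w(e)`, adding `C` to `S` removes more weight than it brings in; as `P_e` has no long edge, it
leaves one long edge fewer. Without long edges, `S` splits into cycles of `G \ L`, where `B` meets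
the criterion.

Independence: `e` lies in no member of the family other than `{e} ∪ P_e`. -/

/-- The indicator vector of an edge set over the field with two elements. -/
def edgeVec {V : Type*} [DecidableEq V] (S : Finset (Sym2 V)) : Sym2 V → ZMod 2 :=
  fun e => if e ∈ S then 1 else 0

/-- Every vertex is incident to an even number of edges of `S`. -/
def IsEvenSet {V : Type*} [Fintype V] [DecidableEq V] (S : Finset (Sym2 V)) : Prop :=
  ∀ v : V, ∑ e ∈ Finset.univ.filter (fun e : Sym2 V => v ∈ e), edgeVec S e = 0

/-! ### Linear algebra of edge sets and the weight criterion for cycle bases -/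

section

variable {V : Type*} [DecidableEq V]

lemma edgeVec_symmDiff (S T : Finset (Sym2 V)) :
    edgeVec (symmDiff S T) = edgeVec S + edgeVec T := by
  funext e
  have h2 : (1 : ZMod 2) + 1 = 0 := by decide
  by_cases h₁ : e ∈ S <;> by_cases h₂ : e ∈ T <;>
    simp [edgeVec, Finset.mem_symmDiff, h₁, h₂, h2]

lemma edgeVec_injective : Function.Injective (edgeVec (V := V)) := by
  intro S T h
  ext e
  have := congrFun h e
  by_cases h₁ : e ∈ S <;> by_cases h₂ : e ∈ T <;> simp_all [edgeVec]

lemma edgeVec_empty : edgeVec (∅ : Finset (Sym2 V)) = 0 := by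
  funext e; simp [edgeVec]

variable [Fintype V]

lemma IsEvenSet.symmDiff_isEvenSet {S T : Finset (Sym2 V)} (hS : IsEvenSet S) (hT : IsEvenSet T) :
    IsEvenSet (symmDiff S T) := by
  intro v
  simp [edgeVec_symmDiff, Finset.sum_add_distrib, hS v, hT v]

lemma edgeVec_xorSum (F : Finset (Finset (Sym2 V))) :
    edgeVec (xorSum F) = ∑ C ∈ F, edgeVec C := by
  funext e
  simp only [edgeVec, xorSum, Finset.mem_filter, Finset.mem_univ, true_and, Finset.sum_apply,
    Finset.sum_boole]
  split_ifs with h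
  · exact (ZMod.natCast_eq_one_iff_odd.mpr h).symm
  · exact (ZMod.natCast_eq_zero_iff_even.mpr (Nat.not_odd_iff_even.mp h)).symm

/-- Coefficients in `ZMod 2` are 0 or 1, so a linear combination is the choice of a subfamily. -/
lemma exists_xorSum_eq_iff (B : Finset (Finset (Sym2 V))) (C : Finset (Sym2 V)) :
    (∃ F ⊆ B, xorSum F = C) ↔ edgeVec C ∈ Submodule.span (ZMod 2) (edgeVec '' (B : Set _)) := by
  constructor
  · rintro ⟨F, hF, rfl⟩
    rw [edgeVec_xorSum]
    exact Submodule.sum_mem _ fun D hD => Submodule.subset_span ⟨D, hF hD, rfl⟩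
  · intro h
    obtain ⟨c, hc⟩ := (Submodule.mem_span_image_finset_iff_exists_fun' (ZMod 2)).mp h
    refine ⟨B.filter fun D => c D = 1, Finset.filter_subset _ _, edgeVec_injective ?_⟩
    rw [edgeVec_xorSum, Finset.sum_filter, ← hc]
    refine Finset.sum_congr rfl fun D _ => ?_
    have : ∀ x : ZMod 2, x = 1 ∨ x = 0 := by decide
    rcases this (c D) with h | h <;> simp [h]

lemma spansCycleSpace_iff (G : SimpleGraph V) (B : Finset (Finset (Sym2 V))) :
    SpansCycleSpace G B ↔ (∀ C ∈ B, IsCycleOf G C) ∧ ∀ C, IsCycleOf G C →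
      edgeVec C ∈ Submodule.span (ZMod 2) (edgeVec '' (B : Set _)) := by
  simp only [SpansCycleSpace, exists_xorSum_eq_iff]

lemma card_le_card_of_linearIndepOn {S N : Finset (Finset (Sym2 V))}
    (hS : LinearIndepOn (ZMod 2) edgeVec (S : Set (Finset (Sym2 V))))
    (h : ∀ C ∈ S, edgeVec C ∈ Submodule.span (ZMod 2) (edgeVec '' (N : Set _))) :
    S.card ≤ N.card := by
  classical
  have h₁ : Module.finrank (ZMod 2)
      (Submodule.span (ZMod 2) (↑(S.image edgeVec) : Set (Sym2 V → ZMod 2))) =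
      (S.image edgeVec).card := by
    apply finrank_span_finset_eq_card
    simpa only [Finset.coe_image] using hS.id_image
  have h₂ := finrank_span_finset_le_card (R := ZMod 2) (N.image edgeVec)
  rw [Finset.card_image_of_injective _ edgeVec_injective] at h₁ h₂
  rw [← h₁]
  refine le_trans (Submodule.finrank_mono ?_) h₂
  rw [Submodule.span_le]
  intro x hx
  simp only [Finset.coe_image, Set.mem_image, Finset.mem_coe] at hx
  obtain ⟨C, hC, rfl⟩ := hx
  simpa using h C hC

/-- Deleting a redundant member, or exchanging it for an equivalent cycle, keeps a spanning set. -/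
lemma SpansCycleSpace.of_mem_span {G : SimpleGraph V} {B B' : Finset (Finset (Sym2 V))}
    (hB : SpansCycleSpace G B) (hB' : ∀ C ∈ B', IsCycleOf G C)
    (h : ∀ C ∈ B, edgeVec C ∈ Submodule.span (ZMod 2) (edgeVec '' (B' : Set _))) :
    SpansCycleSpace G B' := by
  rw [spansCycleSpace_iff] at hB ⊢
  refine ⟨hB', fun C hC => ?_⟩
  refine Submodule.span_le.mpr ?_ (hB.2 C hC)
  rintro _ ⟨D, hD, rfl⟩
  exact h D hD

/-- A member in the span of the others could be dropped, against minimum cardinality. -/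
lemma IsCycleBasis.linearIndepOn {G : SimpleGraph V} {B : Finset (Finset (Sym2 V))}
    (hB : IsCycleBasis G B) :
    LinearIndepOn (ZMod 2) edgeVec (B : Set (Finset (Sym2 V))) := by
  rw [linearIndepOn_iff_notMem_span]
  intro C hC hmem
  have hsp : SpansCycleSpace G (B.erase C) := by
    refine hB.1.of_mem_span (fun D hD => hB.1.1 D (Finset.mem_of_mem_erase hD)) fun D hD => ?_
    by_cases hDC : D = C
    · subst hDC
      simpa using hmem
    · exact Submodule.subset_span ⟨D, by simpa using ⟨hD, hDC⟩, rfl⟩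
  have h₁ := hB.2 _ hsp
  have h₂ := Finset.card_erase_lt_of_mem (Finset.mem_coe.mp hC)
  omega

lemma isCycleBasis_of_linearIndepOn {G : SimpleGraph V} {B : Finset (Finset (Sym2 V))}
    (hB : SpansCycleSpace G B)
    (hi : LinearIndepOn (ZMod 2) edgeVec (B : Set (Finset (Sym2 V)))) : IsCycleBasis G B := by
  refine ⟨hB, fun B' hB' => card_le_card_of_linearIndepOn hi fun C hC => ?_⟩
  exact ((spansCycleSpace_iff G B').mp hB').2 C (hB.1 C hC)

/-- Exchange property of minimum cycle bases. -/
lemma IsMinCycleBasis.mem_span_filter {G : SimpleGraph V} {w : Sym2 V → ℝ}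
    {B : Finset (Finset (Sym2 V))} (hB : IsMinCycleBasis G w B) {D : Finset (Sym2 V)}
    (hD : IsCycleOf G D) :
    edgeVec D ∈ Submodule.span (ZMod 2)
      (edgeVec '' {C | C ∈ B ∧ ∑ e ∈ C, w e ≤ ∑ e ∈ D, w e}) := by
  obtain ⟨F, hF, hFD⟩ := hB.1.1.2 D hD
  have hsum : edgeVec D = ∑ C ∈ F, edgeVec C := by rw [← hFD, edgeVec_xorSum]
  rw [hsum]
  refine Submodule.sum_mem _ fun C hC => Submodule.subset_span ⟨C, ⟨hF hC, ?_⟩, rfl⟩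
  -- If a summand `C` were heavier than `D`, exchanging `C` for `D` would give a lighter cycle
  -- basis.
  by_contra! hlt
  have hsp : SpansCycleSpace G (insert D (B.erase C)) := by
    refine hB.1.1.of_mem_span (fun A hA => ?_) fun A hA => ?_
    · rcases Finset.mem_insert.mp hA with rfl | hA
      · exact hD
      · exact hB.1.1.1 A (Finset.mem_of_mem_erase hA)
    · by_cases hAC : A = C
      · subst hAC
        have : edgeVec A = edgeVec D - ∑ C ∈ F.erase A, edgeVec C := by
          rw [hsum, ← Finset.add_sum_erase F _ hC, add_sub_cancel_right]
        rw [this]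
        refine Submodule.sub_mem _ (Submodule.subset_span ⟨D, by simp, rfl⟩)
          (Submodule.sum_mem _ fun E hE => Submodule.subset_span ⟨E, ?_, rfl⟩)
        rw [Finset.mem_erase] at hE
        simp [hE.1, hF hE.2]
      · exact Submodule.subset_span ⟨A, by simp [hAC, hA], rfl⟩
  have hCB := hF hC
  have hcard := hB.1.2 _ hsp
  have herase := Finset.card_erase_add_one hCB
  have hDn : D ∉ B.erase C := by
    intro hmem
    rw [Finset.insert_eq_self.mpr hmem] at hcard
    omega
  have hins := Finset.card_insert_of_notMem hDn
  have hbasis : IsCycleBasis G (insert D (B.erase C)) :=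
    ⟨hsp, fun B' hB' => by have := hB.1.2 B' hB'; omega⟩
  have hw := hB.2 _ hbasis
  rw [Finset.sum_insert hDn, ← Finset.add_sum_erase B _ hCB] at hw
  linarith

/-- A cycle basis is minimum if every cycle is a sum of members that are not heavier. -/
lemma isMinCycleBasis_of_mem_span_filter {G : SimpleGraph V} {w : Sym2 V → ℝ}
    {B : Finset (Finset (Sym2 V))} (hB : IsCycleBasis G B)
    (h : ∀ D, IsCycleOf G D → edgeVec D ∈ Submodule.span (ZMod 2)
      (edgeVec '' {C | C ∈ B ∧ ∑ e ∈ C, w e ≤ ∑ e ∈ D, w e})) :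
    IsMinCycleBasis G w B := by
  classical
  refine ⟨hB, fun B' hB' => ?_⟩
  have hi := hB'.linearIndepOn
  -- Hall's theorem will match each `D` in `B'` with a member of `B` that is not heavier.
  let t : B' → Finset (Finset (Sym2 V)) := fun D =>
    B.filter fun C => ∑ e ∈ C, w e ≤ ∑ e ∈ D.1, w e
  have hall : ∀ s : Finset B', s.card ≤ (s.biUnion t).card := by
    intro s
    rcases s.eq_empty_or_nonempty with rfl | hs
    · simp
    -- The candidates for the heaviest `M` in `s` already span all of `s`, which is independent;
    -- this is Hall's condition.
    obtain ⟨M, hM, hmax⟩ := s.exists_max_image (fun D => ∑ e ∈ D.1, w e) hs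
    rw [← Finset.card_map (Function.Embedding.subtype _)]
    refine card_le_card_of_linearIndepOn (hi.mono ?_) ?_
    · intro C hC
      simp at hC
      exact hC.1
    · intro C hC
      obtain ⟨D, hD, rfl⟩ := Finset.mem_map.mp hC
      refine Submodule.span_mono (Set.image_mono ?_) (h D.1 (hB'.1.1 _ D.2))
      intro A hA
      simp only [Finset.coe_biUnion, Set.mem_iUnion]
      exact ⟨M, hM, by simpa [t] using ⟨hA.1, hA.2.trans (hmax D hD)⟩⟩
  obtain ⟨f, hf, hft⟩ := (Finset.all_card_le_biUnion_card_iff_exists_injective t).mp hall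
  -- The matching is onto, because `B` has at most as many members as `B'`.
  have himg : Finset.univ.image f = B := by
    apply Finset.eq_of_subset_of_card_le
    · intro C hC
      obtain ⟨D, -, rfl⟩ := Finset.mem_image.mp hC
      exact (Finset.mem_filter.mp (hft D)).1
    · rw [Finset.card_image_of_injective _ hf, Finset.card_univ, Fintype.card_coe]
      exact hB.2 _ hB'.1
  rw [← himg, Finset.sum_image fun a _ b _ hab => hf hab,
    ← Finset.sum_coe_sort B' fun C => ∑ e ∈ C, w e]
  exact Finset.sum_le_sum fun D _ => (Finset.mem_filter.mp (hft D)).2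

end

/-! ### Walks, cycles and even edge sets -/

lemma walkWeight_toWalk {V : Type*} {G : SimpleGraph V} (w : Sym2 V → ℝ) {u v : V} (h : G.Adj u v) :
    walkWeight w h.toWalk = w s(u, v) := by
  simp [walkWeight]

lemma walkWeight_reverse {V : Type*} {G : SimpleGraph V} (w : Sym2 V → ℝ) {u v : V} (p : G.Walk u v) :
    walkWeight w p.reverse = walkWeight w p := by
  simp [walkWeight, List.sum_reverse]

section

variable {V : Type*} [DecidableEq V]

lemma walkWeight_eq_sum {G : SimpleGraph V} (w : Sym2 V → ℝ) {u v : V} {p : G.Walk u v}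
    (hp : p.IsPath) : walkWeight w p = ∑ e ∈ p.edges.toFinset, w e := by
  rw [List.sum_toFinset _ hp.isTrail.edges_nodup, walkWeight]

/-- In a graph with nonnegative weights a walk contains a path which is not heavier. -/
lemma walkWeight_bypass_le {G : SimpleGraph V} {w : Sym2 V → ℝ}
    (hw : ∀ e ∈ G.edgeSet, 0 ≤ w e) {u v : V} (p : G.Walk u v) :
    walkWeight w p.bypass ≤ walkWeight w p := by
  refine (p.edges_bypass_sublist_edges.map w).sum_le_sum ?_
  intro x hx
  obtain ⟨e, he, rfl⟩ := List.mem_map.mp hx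
  exact hw e (p.edges_subset_edgeSet he)

/-- Replacing an edge of a walk by another walk between its ends. -/
lemma exists_walk_replace_edge {G : SimpleGraph V} (w : Sym2 V → ℝ) {x y : V} (q : G.Walk x y)
    {u v : V} (p : G.Walk u v) (h : s(x, y) ∈ p.edges) :
    ∃ p' : G.Walk u v, walkWeight w p' + w s(x, y) = walkWeight w p + walkWeight w q := by
  induction p with
  | nil => simp at h
  | @cons a b c hab p ih =>
    by_cases hxy : s(x, y) = s(a, b)
    · have : ∃ r : G.Walk a b, walkWeight w r = walkWeight w q := by
        rcases Sym2.eq_iff.mp hxy with ⟨rfl, rfl⟩ | ⟨rfl, rfl⟩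
        · exact ⟨q, rfl⟩
        · exact ⟨q.reverse, walkWeight_reverse w q⟩
      obtain ⟨r, hr⟩ := this
      refine ⟨r.append p, ?_⟩
      rw [← hr, hxy]
      simp [walkWeight]
      ring
    · have h' : s(x, y) ∈ p.edges := by
        simpa [hxy] using h
      obtain ⟨p', hp'⟩ := ih h'
      refine ⟨SimpleGraph.Walk.cons hab p', ?_⟩
      simp only [walkWeight, SimpleGraph.Walk.edges_cons, List.map_cons, List.sum_cons] at hp' ⊢
      linarith

lemma isCycleOf_insert_edges {G : SimpleGraph V} {u v : V} (h : G.Adj u v) {p : G.Walk u v}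
    (hp : p.IsPath) (hn : s(u, v) ∉ p.edges) :
    IsCycleOf G (insert s(u, v) p.edges.toFinset) := by
  refine ⟨v, SimpleGraph.Walk.cons h.symm p, ?_, ?_⟩
  · rw [SimpleGraph.Walk.cons_isCycle_iff]
    exact ⟨hp, by rwa [Sym2.eq_swap]⟩
  · rw [SimpleGraph.Walk.edges_cons, List.toFinset_cons, Sym2.eq_swap]

lemma IsCycleOf.subset_edgeSet {G : SimpleGraph V} {C : Finset (Sym2 V)} (h : IsCycleOf G C) :
    (C : Set (Sym2 V)) ⊆ G.edgeSet := by
  obtain ⟨u, p, -, rfl⟩ := h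
  intro e he
  exact p.edges_subset_edgeSet (by simpa using he)

lemma IsCycleOf.of_subset_edgeSet {G H : SimpleGraph V} {C : Finset (Sym2 V)}
    (h : IsCycleOf G C) (hC : (C : Set (Sym2 V)) ⊆ H.edgeSet) : IsCycleOf H C := by
  obtain ⟨u, p, hp, rfl⟩ := h
  have hq : ∀ e ∈ p.edges, e ∈ H.edgeSet := fun e he => hC (by simpa using he)
  exact ⟨u, p.transfer H hq, hp.transfer hq, by rw [SimpleGraph.Walk.edges_transfer]⟩

variable [Fintype V]

lemma IsCycleOf.isEvenSet {G : SimpleGraph V} {C : Finset (Sym2 V)} (h : IsCycleOf G C) :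
    IsEvenSet C := by
  obtain ⟨u, p, hp, rfl⟩ := h
  intro v
  have h₁ := (hp.isTrail.even_countP_edges_iff v).mpr fun h => absurd rfl h
  have h₂ : ((Finset.univ.filter fun e : Sym2 V => v ∈ e).filter
      fun e => e ∈ p.edges.toFinset).card = p.edges.countP fun e => v ∈ e := by
    rw [List.countP_eq_length_filter,
      ← List.toFinset_card_of_nodup (hp.isTrail.edges_nodup.filter _)]
    congr 1
    ext e
    simp [and_comm]
  simp only [edgeVec, Finset.sum_boole]
  rw [h₂]
  exact ZMod.natCast_eq_zero_iff_even.mpr h₁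

/-- The ends of an edge of an even edge set are joined by a path through the other edges. -/
lemma IsEvenSet.exists_path {G : SimpleGraph V} {S : Finset (Sym2 V)} (hS : IsEvenSet S)
    (hG : (S : Set (Sym2 V)) ⊆ G.edgeSet) {u v : V} (he : s(u, v) ∈ S) :
    ∃ p : G.Walk u v, p.IsPath ∧ p.edges.toFinset ⊆ S.erase s(u, v) := by
  classical
  set H := SimpleGraph.fromEdgeSet ((S.erase s(u, v) : Finset (Sym2 V)) : Set (Sym2 V)) with hH
  have hHG : H ≤ G := by
    intro a b hab
    rw [hH, SimpleGraph.fromEdgeSet_adj] at hab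
    exact hG (Finset.mem_of_mem_erase hab.1)
  have hne : u ≠ v := (G.mem_edgeSet.mp (hG he)).ne
  have hr : H.Reachable u v := by
    by_contra hn
    -- Sum the degrees in `S` over the component `K` of `u` in `S` without `s(u, v)`. If `v ∉ K`,
    -- then `s(u, v)` counts once and every other edge zero or two times, so the sum is odd.
    let K : Finset V := Finset.univ.filter fun x => H.Reachable u x
    have h0 : ∑ x ∈ K, ∑ f ∈ Finset.univ.filter (fun f : Sym2 V => x ∈ f), edgeVec S f = 0 :=
      Finset.sum_eq_zero fun x _ => hS x
    have h1 : ∑ x ∈ K, ∑ f ∈ Finset.univ.filter (fun f : Sym2 V => x ∈ f), edgeVec S f =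
        ∑ f : Sym2 V, ∑ x ∈ K.filter (fun x => x ∈ f), edgeVec S f := by
      simp only [Finset.sum_filter]
      exact Finset.sum_comm
    have h2 : ∀ f : Sym2 V, f ≠ s(u, v) → ∑ x ∈ K.filter (fun x => x ∈ f), edgeVec S f = 0 := by
      intro f hf
      by_cases hfS : f ∈ S
      · induction f with | _ a b
        have hab : a ≠ b := (G.mem_edgeSet.mp (hG hfS)).ne
        have hadj : H.Adj a b := by
          rw [hH, SimpleGraph.fromEdgeSet_adj]
          exact ⟨by simp [hfS]; simpa using hf, hab⟩
        have hiff : H.Reachable u a ↔ H.Reachable u b :=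
          ⟨fun h => h.trans hadj.reachable, fun h => h.trans hadj.symm.reachable⟩
        rw [Finset.sum_const]
        by_cases hra : H.Reachable u a
        · have : K.filter (fun x => x ∈ s(a, b)) = {a, b} := by
            ext x
            simp only [K, Finset.mem_filter, Finset.mem_univ, true_and, Sym2.mem_iff,
              Finset.mem_insert, Finset.mem_singleton]
            constructor
            · exact fun h => h.2
            · rintro (rfl | rfl)
              · exact ⟨hra, Or.inl rfl⟩
              · exact ⟨hiff.mp hra, Or.inr rfl⟩
          rw [this, Finset.card_pair hab, two_nsmul]
          exact CharTwo.add_self_eq_zero _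
        · have : K.filter (fun x => x ∈ s(a, b)) = ∅ := by
            ext x
            simp only [K, Finset.mem_filter, Finset.mem_univ, true_and, Sym2.mem_iff,
              Finset.notMem_empty, iff_false, not_and]
            rintro hx (rfl | rfl)
            · exact hra hx
            · exact hra (hiff.mpr hx)
          rw [this]
          simp
      · simp [edgeVec, hfS]
    rw [h1, Finset.sum_eq_single s(u, v) (fun f _ hf => h2 f hf) (by simp)] at h0
    have : K.filter (fun x => x ∈ s(u, v)) = {u} := by
      ext x
      simp only [K, Finset.mem_filter, Finset.mem_univ, true_and, Sym2.mem_iff,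
        Finset.mem_singleton]
      constructor
      · rintro ⟨hx, rfl | rfl⟩
        · rfl
        · exact absurd hx hn
      · rintro rfl
        exact ⟨SimpleGraph.Reachable.refl _, Or.inl rfl⟩
    rw [this] at h0
    simp [edgeVec, he] at h0
  obtain ⟨p, hp⟩ := hr.exists_isPath
  refine ⟨p.mapLe hHG, (SimpleGraph.Walk.isPath_mapLe hHG).mpr hp, ?_⟩
  intro f hf
  have hf' : f ∈ p.edges := by simpa using hf
  have := p.edges_subset_edgeSet hf'
  rw [hH, SimpleGraph.edgeSet_fromEdgeSet] at this
  exact this.1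

end

/-! ### Long edges and shortest paths -/

section

variable {V : Type*} [Fintype V] [DecidableEq V]

lemma mk_mem_longEdges {G : SimpleGraph V} {w : Sym2 V → ℝ} {u v : V} :
    s(u, v) ∈ longEdges G w ↔
      G.Adj u v ∧ ∃ q : G.Walk u v, q.IsPath ∧ walkWeight w q < w s(u, v) := by
  have key : ∀ (a b : V) (h : G.Adj a b), ¬ IsShortestPath w h.toWalk ↔
      ∃ q : G.Walk a b, q.IsPath ∧ walkWeight w q < w s(a, b) := by
    intro a b h
    have hp : h.toWalk.IsPath := by simp [h.ne]
    simp only [IsShortestPath, hp, true_and, not_forall, not_le, walkWeight_toWalk, exists_prop]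
  simp only [longEdges, Finset.mem_filter, Finset.mem_univ, true_and]
  constructor
  · rintro ⟨a, b, h, hab, hs⟩
    rw [key] at hs
    obtain ⟨q, hq, hqw⟩ := hs
    rcases Sym2.eq_iff.mp hab with ⟨rfl, rfl⟩ | ⟨rfl, rfl⟩
    · exact ⟨h, q, hq, hqw⟩
    · exact ⟨h.symm, q.reverse, hq.reverse, by rwa [walkWeight_reverse, Sym2.eq_swap]⟩
  · rintro ⟨h, hq⟩
    exact ⟨u, v, h, rfl, (key u v h).mpr hq⟩

/-- A shortest path contains no long edge. -/
lemma IsShortestPath.notMem_longEdges {G : SimpleGraph V} {w : Sym2 V → ℝ}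
    (hw : ∀ e ∈ G.edgeSet, 0 ≤ w e) {u v : V} {p : G.Walk u v} (hp : IsShortestPath w p)
    {f : Sym2 V} (hf : f ∈ p.edges) : f ∉ longEdges G w := by
  intro hL
  induction f with | _ x y
  obtain ⟨-, q, -, hq⟩ := mk_mem_longEdges.mp hL
  -- Replacing the long edge by the lighter `q` gives a walk, and hence a path, lighter than `p`.
  obtain ⟨p', hp'⟩ := exists_walk_replace_edge w q p hf
  have h₁ := hp.2 p'.bypass p'.bypass_isPath
  have h₂ := walkWeight_bypass_le hw p'
  linarith

section

variable {G : SimpleGraph V} {w : Sym2 V → ℝ} {e : Sym2 V} {P : Finset (Sym2 V)}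

lemma IsShortestPathFor.disjoint_longEdges (hw : ∀ e ∈ G.edgeSet, 0 ≤ w e)
    (h : IsShortestPathFor G w e P) : Disjoint P (longEdges G w) := by
  obtain ⟨u, v, p, rfl, hp, rfl⟩ := h
  rw [Finset.disjoint_left]
  intro f hf
  exact hp.notMem_longEdges hw (by simpa using hf)

lemma IsShortestPathFor.isCycleOf (hw : ∀ e ∈ G.edgeSet, 0 ≤ w e)
    (he : e ∈ longEdges G w) (h : IsShortestPathFor G w e P) : IsCycleOf G (insert e P) := by
  obtain ⟨u, v, p, rfl, hp, rfl⟩ := h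
  exact isCycleOf_insert_edges (mk_mem_longEdges.mp he).1 hp.1
    fun hm => hp.notMem_longEdges hw hm he

lemma IsShortestPathFor.sum_lt (he : e ∈ longEdges G w) (h : IsShortestPathFor G w e P) :
    ∑ f ∈ P, w f < w e := by
  obtain ⟨u, v, p, rfl, hp, rfl⟩ := h
  obtain ⟨-, q, hq, hqw⟩ := mk_mem_longEdges.mp he
  rw [← walkWeight_eq_sum w hp.1]
  exact (hp.2 q hq).trans_lt hqw

/-- By parity, `S` without `e` still contains a path between the ends of `e`. -/
lemma IsShortestPathFor.sum_le_sum_erase (hw : ∀ e ∈ G.edgeSet, 0 ≤ w e)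
    (h : IsShortestPathFor G w e P) {S : Finset (Sym2 V)} (hS : IsEvenSet S)
    (hG : (S : Set (Sym2 V)) ⊆ G.edgeSet) (he : e ∈ S) :
    ∑ f ∈ P, w f ≤ ∑ f ∈ S.erase e, w f := by
  obtain ⟨u, v, p, rfl, hp, rfl⟩ := h
  obtain ⟨q, hq, hqS⟩ := hS.exists_path hG he
  rw [← walkWeight_eq_sum w hp.1]
  refine (hp.2 q hq).trans ?_
  rw [walkWeight_eq_sum w hq]
  exact Finset.sum_le_sum_of_subset_of_nonneg hqS fun f hf _ =>
    hw f (hG (Finset.mem_of_mem_erase hf))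

end

lemma sum_symmDiff_add {α : Type*} [DecidableEq α] (w : α → ℝ) (S T : Finset α) :
    ∑ e ∈ symmDiff S T, w e + 2 * ∑ e ∈ S ∩ T, w e = ∑ e ∈ S, w e + ∑ e ∈ T, w e := by
  have h : symmDiff S T = S \ T ∪ T \ S := rfl
  rw [h, Finset.sum_union disjoint_sdiff_sdiff, ← Finset.sum_inter_add_sum_sdiff S T,
    ← Finset.sum_inter_add_sum_sdiff T S, Finset.inter_comm T S]
  ring

/-- Even edge sets are sums of cycles which are not heavier. -/
lemma IsEvenSet.mem_span_of_isCycleOf {G : SimpleGraph V} {w : Sym2 V → ℝ}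
    (hw : ∀ e ∈ G.edgeSet, 0 ≤ w e) {M : Submodule (ZMod 2) (Sym2 V → ZMod 2)} {W : ℝ}
    (hM : ∀ D, IsCycleOf G D → ∑ e ∈ D, w e ≤ W → edgeVec D ∈ M) {S : Finset (Sym2 V)}
    (hS : IsEvenSet S) (hG : (S : Set (Sym2 V)) ⊆ G.edgeSet) (hSW : ∑ e ∈ S, w e ≤ W) :
    edgeVec S ∈ M := by
  induction S using Finset.strongInduction with | _ S ih
  rcases S.eq_empty_or_nonempty with rfl | ⟨e, he⟩
  · rw [edgeVec_empty]
    exact M.zero_mem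
  induction e with | _ u v
  obtain ⟨p, hp, hpS⟩ := hS.exists_path hG he
  have hD := isCycleOf_insert_edges (G.mem_edgeSet.mp (hG he)) hp
    fun hm => by simpa using hpS (List.mem_toFinset.mpr hm)
  set D := insert s(u, v) p.edges.toFinset with hDdef
  have hDS : D ⊆ S :=
    Finset.insert_subset he (hpS.trans (Finset.erase_subset _ _))
  -- Both `D` and `S \ D` are subsets of `S`, so nonnegativity keeps them within the bound `W`.
  have hsub : ∀ T ⊆ S, ∑ e ∈ T, w e ≤ W := fun T hT =>
    (Finset.sum_le_sum_of_subset_of_nonneg hT fun f hf _ => hw f (hG hf)).trans hSW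
  have hdiff : symmDiff S D = S \ D := by
    rw [symmDiff_of_ge hDS]
  have hev := hS.symmDiff_isEvenSet hD.isEvenSet
  have hvec : edgeVec S = edgeVec (symmDiff S D) + edgeVec D := by
    rw [← edgeVec_symmDiff, symmDiff_symmDiff_cancel_right]
  rw [hvec]
  rw [hdiff] at hev ⊢
  refine M.add_mem (ih _ ?_ hev ?_ (hsub _ Finset.sdiff_subset)) (hM D hD (hsub D hDS))
  · exact Finset.sdiff_ssubset hDS ⟨s(u, v), by simp [hDdef]⟩
  · exact fun f hf => hG (Finset.sdiff_subset hf)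

/-- Every even edge set is a sum of cycles which are not heavier and are either without long edges
or consist of a long edge and a shortest path between its ends. -/
lemma IsEvenSet.mem_span_of_longEdges {G : SimpleGraph V} {w : Sym2 V → ℝ}
    (hw : ∀ e ∈ G.edgeSet, 0 ≤ w e) {short : Sym2 V → Finset (Sym2 V)}
    (hshort : ∀ e ∈ longEdges G w, IsShortestPathFor G w e (short e))
    {M : Submodule (ZMod 2) (Sym2 V → ZMod 2)} {W : ℝ}
    (hM : ∀ D, IsCycleOf (G.deleteEdges (longEdges G w : Set (Sym2 V))) D →
      ∑ e ∈ D, w e ≤ W → edgeVec D ∈ M)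
    (hML : ∀ e ∈ longEdges G w, ∑ f ∈ insert e (short e), w f ≤ W →
      edgeVec (insert e (short e)) ∈ M)
    {S : Finset (Sym2 V)} (hS : IsEvenSet S) (hG : (S : Set (Sym2 V)) ⊆ G.edgeSet)
    (hSW : ∑ e ∈ S, w e ≤ W) : edgeVec S ∈ M := by
  induction hn : (S ∩ longEdges G w).card using Nat.strong_induction_on generalizing S with
  | _ n ih
  rcases (S ∩ longEdges G w).eq_empty_or_nonempty with h0 | ⟨e, he⟩
  · refine IsEvenSet.mem_span_of_isCycleOf (fun f hf => hw f ?_) hM hS ?_ hSW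
    · exact SimpleGraph.edgeSet_mono (SimpleGraph.deleteEdges_le _) hf
    · intro f hf
      rw [SimpleGraph.edgeSet_deleteEdges]
      refine ⟨hG hf, fun hfL => ?_⟩
      have : f ∈ S ∩ longEdges G w := Finset.mem_inter.mpr ⟨hf, hfL⟩
      simp [h0] at this
  · obtain ⟨heS, heL⟩ := Finset.mem_inter.mp he
    have hsp := hshort e heL
    have hcyc := hsp.isCycleOf hw heL
    have hdis := hsp.disjoint_longEdges hw
    have hePn : e ∉ short e := fun hm => Finset.disjoint_left.mp hdis hm heL
    set C := insert e (short e) with hC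
    have hCw : ∑ f ∈ C, w f = w e + ∑ f ∈ short e, w f := Finset.sum_insert hePn
    have hSe := Finset.add_sum_erase S w heS
    have h₁ := hsp.sum_le_sum_erase hw hS hG heS
    have h₂ := hsp.sum_lt heL
    -- The edge `e` is shared by `S` and `C`, so the symmetric difference loses `w e` twice.
    have hint : w e ≤ ∑ f ∈ S ∩ C, w f :=
      Finset.single_le_sum (f := w) (fun f hf => hw f (hG (Finset.mem_inter.mp hf).1))
        (Finset.mem_inter.mpr ⟨heS, Finset.mem_insert_self _ _⟩)
    have hsd := sum_symmDiff_add w S C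
    have hvec : edgeVec S = edgeVec (symmDiff S C) + edgeVec C := by
      rw [← edgeVec_symmDiff, symmDiff_symmDiff_cancel_right]
    rw [hvec]
    refine M.add_mem (ih _ ?_ (hS.symmDiff_isEvenSet hcyc.isEvenSet) ?_ ?_ rfl) (hML e heL ?_)
    · rw [← hn]
      refine Finset.card_lt_card (Finset.ssubset_iff_subset_ne.mpr ⟨?_, fun heq => ?_⟩)
      · intro f hf
        simp only [Finset.mem_inter, Finset.mem_symmDiff] at hf ⊢
        obtain ⟨⟨h, -⟩ | ⟨hfC, hfS⟩, hfL⟩ := hf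
        · exact ⟨h, hfL⟩
        · rcases Finset.mem_insert.mp hfC with rfl | hfP
          · exact absurd heS hfS
          · exact absurd hfL (Finset.disjoint_left.mp hdis hfP)
      · rw [← heq] at he
        simp [Finset.mem_symmDiff, heS, hC] at he
    · intro f hf
      rcases Finset.mem_symmDiff.mp (Finset.mem_coe.mp hf) with h | h
      · exact hG h.1
      · exact hcyc.subset_edgeSet h.1
    · linarith
    · linarith

end

/-! ### The combined family is a minimum cycle basis -/

theorem mainTheorem5 {V : Type*} [Fintype V] [DecidableEq V] (G : SimpleGraph V)
    (hG : IsPartialKTree 2 G) (w : Sym2 V → ℝ) (hw : ∀ e ∈ G.edgeSet, 0 ≤ w e)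
    (B : Finset (Finset (Sym2 V)))
    (hB : IsMinCycleBasis (G.deleteEdges (longEdges G w : Set (Sym2 V))) w B)
    (short : Sym2 V → Finset (Sym2 V))
    (hshort : ∀ e ∈ longEdges G w, IsShortestPathFor G w e (short e)) :
    IsMinCycleBasis G w (B ∪ (longEdges G w).image fun e => insert e (short e)) := by
  set B₀ := B ∪ (longEdges G w).image fun e => insert e (short e) with hB₀
  have hBL : ∀ C ∈ B, ∀ e ∈ C, e ∈ G.edgeSet ∧ e ∉ longEdges G w := by
    intro C hC e he
    have := (hB.1.1.1 C hC).subset_edgeSet he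
    rwa [SimpleGraph.edgeSet_deleteEdges] at this
  have hlong : ∀ e ∈ longEdges G w, insert e (short e) ∈ B₀ := fun e he =>
    Finset.mem_union_right _ (Finset.mem_image_of_mem _ he)
  have hspan : ∀ D, IsCycleOf G D → edgeVec D ∈ Submodule.span (ZMod 2)
      (edgeVec '' {C | C ∈ B₀ ∧ ∑ e ∈ C, w e ≤ ∑ e ∈ D, w e}) := by
    intro D hD
    refine IsEvenSet.mem_span_of_longEdges hw hshort ?_ ?_ hD.isEvenSet hD.subset_edgeSet le_rfl
    · intro A hA hAD
      refine Submodule.span_mono (Set.image_mono ?_) (hB.mem_span_filter hA)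
      exact fun C hC => ⟨Finset.mem_union_left _ hC.1, hC.2.trans hAD⟩
    · exact fun e he hle => Submodule.subset_span ⟨_, ⟨hlong e he, hle⟩, rfl⟩
  have hcyc : SpansCycleSpace G B₀ := by
    rw [spansCycleSpace_iff]
    refine ⟨fun C hC => ?_, fun D hD =>
      Submodule.span_mono (Set.image_mono fun C hC => hC.1) (hspan D hD)⟩
    rcases Finset.mem_union.mp hC with hC | hC
    · exact (hB.1.1.1 C hC).of_subset_edgeSet fun e he => (hBL C hC e he).1
    · obtain ⟨e, he, rfl⟩ := Finset.mem_image.mp hC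
      exact (hshort e he).isCycleOf hw he
  have hindep : LinearIndepOn (ZMod 2) edgeVec (B₀ : Set (Finset (Sym2 V))) := by
    rw [linearIndepOn_finset_iff]
    intro c hc
    have hcl : ∀ e ∈ longEdges G w, c (insert e (short e)) = 0 := by
      intro e he
      -- At coordinate `e` only the cycle built from `e` is nonzero, so the relation isolates its
      -- coefficient.
      have h := congrFun hc e
      rw [Finset.sum_apply, Finset.sum_eq_single (insert e (short e))] at h
      · simpa [edgeVec] using h
      · intro C hC hne
        have : e ∉ C := by
          intro heC
          rcases Finset.mem_union.mp hC with hC | hC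
          · exact (hBL C hC e heC).2 he
          · obtain ⟨f, hf, rfl⟩ := Finset.mem_image.mp hC
            rcases Finset.mem_insert.mp heC with rfl | hef
            · exact hne rfl
            · exact Finset.disjoint_left.mp ((hshort f hf).disjoint_longEdges hw) hef he
        simp [edgeVec, this]
      · exact fun hn => absurd (hlong e he) hn
    have hsum : ∑ C ∈ B, c C • edgeVec C = 0 := by
      rw [← hc]
      refine Finset.sum_subset Finset.subset_union_left fun C hC hCB => ?_
      obtain ⟨e, he, rfl⟩ := Finset.mem_image.mp ((Finset.mem_union.mp hC).resolve_left hCB)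
      simp only [hcl e he, zero_smul]
    intro C hC
    rcases Finset.mem_union.mp hC with hC | hC
    · exact linearIndepOn_finset_iff.mp hB.1.linearIndepOn c hsum C hC
    · obtain ⟨e, he, rfl⟩ := Finset.mem_image.mp hC
      exact hcl e he
  exact isMinCycleBasis_of_mem_span_filter (isCycleBasis_of_linearIndepOn hcyc hindep) hspan
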